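/- All rings are associative with $1\neq 0$, and subrings contain $1$. A maximal subring of a ring $T$ is a proper subring $S\subsetneq T$ such that no subring lies strictly between $S$ and $T$. Let $T$ be a (not necessarily commutative) reduced ring, i.e. a ring with no nonzero nilpotent elements, and suppose that $T$ is integral over its center $C(T)$, i.e. every element of $T$ is a root of a monic polynomial with coefficients in $C(T)$. A commutative ring is called a Hilbert ring if each of its prime ideals is an intersection of maximal ideals. (1) If $C(T)$ is a Hilbert ring, then either $T$ has a maximal subring, or $T$ is a commutative Hilbert ring with $|T|\leq 2^{2^{\aleph_0}}$. (2) If $C(T)$ is zero-dimensional (i.e. has Krull dimension $0$), then either $T$ has a maximal subring, or $T$ is a commutative Hilbert ring which is von Neumann regular (for every $x\in T$ there is $y\in T$ with $xyx=x$) and $|T|\leq 2^{2^{\aleph_0}}$. -/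

import Mathlib

open scoped Cardinal

/-- A (not necessarily commutative) ring is von Neumann regular if every element `x` can be
written as `x * y * x` for some `y`. -/
def IsVonNeumannRegularRing (R : Type*) [Ring R] : Prop :=
  ∀ x : R, ∃ y : R, x * y * x = x

/-- `T` has a maximal subring: a proper unital subring with no subring strictly between it
and `T`. -/
def HasMaximalSubring (T : Type*) [Ring T] : Prop :=
  ∃ S : Subring T, IsCoatom S

/-- `T` is a commutative Hilbert ring: multiplication in `T` is commutative and, for the resulting
commutative ring structure, `T` is a Hilbert (Jacobson) ring. -/
def IsCommHilbertRing (T : Type*) [inst : Ring T] : Prop :=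
  ∃ h : ∀ x y : T, x * y = y * x,
    @IsJacobsonRing T { inst with mul_comm := h }

/-! Suppose `T`, and hence every quotient of `T`, has no maximal subring. A maximal left ideal `L`
that is not two-sided would have a maximal idealizer, so every `T ⧸ L` is a division ring, algebraic
over its center. A noncentral algebraic element would force a maximal subring (`of_not_mem_center`),
so commutators lie in the Jacobson radical. That radical is zero since `T` is reduced and integral
over a Hilbert ring, so `T` is commutative. Each residue field is then algebraic over some `ZMod p`;
otherwise it is algebraic over a Dedekind domain that is not a field, and has a maximal subring.
Distinct maximal ideals with the same `p` and the same image in `AlgebraicClosure (ZMod p)` would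
give a maximal equalizer. So there are at most `2 ^ ℵ₀` maximal ideals, and `T` embeds in a product
of that many countable fields. -/

/-! ### General constructions of maximal subrings. -/

theorem HasMaximalSubring.of_sup_closure_singleton {T : Type*} [Ring T] {S : Subring T} {x : T}
    (hx : x ∉ S) (h : S ⊔ Subring.closure {x} = ⊤) : HasMaximalSubring T := by
  -- Among the subrings omitting `x`, take a maximal one above `S`; anything larger contains `S` and
  -- `x`.
  obtain ⟨M, hSM, hM⟩ := zorn_le_nonempty₀ {U : Subring T | x ∉ U} (by
    intro c hc hchain y hy
    refine ⟨sSup c, ?_, fun z hz => le_sSup hz⟩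
    intro hxc
    obtain ⟨U, hU, hxU⟩ := (Subring.mem_sSup_of_directedOn ⟨y, hy⟩ hchain.directedOn).1 hxc
    exact hc hU hxU) S hx
  refine ⟨M, ?_, fun U hU => ?_⟩
  · rintro rfl
    exact hM.prop trivial
  · have hxU : x ∈ U := by
      by_contra hxU
      exact hU.not_ge (hM.le_of_ge hxU hU.le)
    rw [eq_top_iff, ← h, sup_le_iff, Subring.closure_le]
    exact ⟨hSM.trans hU.le, by simpa using hxU⟩

theorem HasMaximalSubring.of_surjective {T R : Type*} [Ring T] [Ring R] (f : T →+* R)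
    (hf : Function.Surjective f) (h : HasMaximalSubring R) : HasMaximalSubring T := by
  obtain ⟨S, hS, hmax⟩ := h
  refine ⟨S.comap f, ?_, fun U hU => ?_⟩
  · intro h
    refine hS (eq_top_iff.2 fun r _ => ?_)
    obtain ⟨t, rfl⟩ := hf r
    have : t ∈ S.comap f := h ▸ trivial
    exact this
  · obtain ⟨u, huU, huS⟩ := SetLike.exists_of_lt hU
    have hlt : S < U.map f := by
      refine SetLike.lt_iff_le_and_exists.2 ⟨fun s hs => ?_, f u, ⟨u, huU, rfl⟩, huS⟩
      obtain ⟨t, rfl⟩ := hf s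
      exact ⟨t, hU.le hs, rfl⟩
    refine eq_top_iff.2 fun t _ => ?_
    have : f t ∈ U.map f := (hmax _ hlt) ▸ trivial
    obtain ⟨u', hu', h'⟩ := this
    have : t - u' ∈ S.comap f := by simp [Subring.mem_comap, h']
    simpa using add_mem (hU.le this) hu'

/-- The idealizer of a left ideal. -/
def Ideal.idealizer {T : Type*} [Ring T] (L : Ideal T) : Subring T where
  carrier := {r | ∀ l ∈ L, l * r ∈ L}
  mul_mem' {a b} ha hb l hl := by simpa [mul_assoc] using hb _ (ha l hl)
  one_mem' l hl := by simpa using hl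
  add_mem' {a b} ha hb l hl := by simpa [mul_add] using add_mem (ha l hl) (hb l hl)
  zero_mem' l _ := by simp
  neg_mem' {a} ha l hl := by simpa using ha l hl

theorem Ideal.IsMaximal.isTwoSided_of_not_hasMaximalSubring {T : Type*} [Ring T] {L : Ideal T}
    (hL : L.IsMaximal) (h : ¬ HasMaximalSubring T) : L.IsTwoSided := by
  by_contra hL2
  refine h ⟨L.idealizer, ?_, fun U hU => ?_⟩
  · intro htop
    refine hL2 ⟨fun {a} b ha => ?_⟩
    have : b ∈ L.idealizer := htop ▸ trivial
    exact this a ha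
  · obtain ⟨r, hrU, hr⟩ := SetLike.exists_of_lt hU
    have hr : ¬ ∀ l ∈ L, l * r ∈ L := hr
    push Not at hr
    obtain ⟨l, hl, hlr⟩ := hr
    have hLI : ∀ x ∈ L, x ∈ U := fun x hx => hU.le fun y _ => L.mul_mem_left y hx
    refine eq_top_iff.2 fun t _ => ?_
    -- Since `T * l ⊆ L ⊆ U`, writing `1` as a multiple of `l * r` modulo `L` puts every `t` in `U`.
    obtain ⟨y, i, hi, hyi⟩ := hL.exists_inv hlr
    have : t = (t * y * l) * r + t * i := by
      calc t = t * (y * (l * r) + i) := by rw [hyi, mul_one]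
        _ = _ := by noncomm_ring
    rw [this]
    exact add_mem (mul_mem (hLI _ (L.mul_mem_left _ hl)) hrU) (hLI _ (L.mul_mem_left _ hi))

/-- By the Chinese remainder theorem `T` maps onto `K × K`, with `K` the common image, a field. The
equalizer is the preimage of the diagonal, which is maximal there. -/
theorem HasMaximalSubring.of_ringHom_pair {T Ω : Type*} [CommRing T] [Field Ω] (f g : T →+* Ω)
    (hf : (RingHom.ker f).IsMaximal) (hg : (RingHom.ker g).IsMaximal)
    (hne : RingHom.ker f ≠ RingHom.ker g) (hr : Set.range f = Set.range g) :
    HasMaximalSubring T := by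
  obtain ⟨m, hm, n, hn, hmn⟩ := Submodule.mem_sup.1
    ((Ideal.eq_top_iff_one _).1 (hf.coprime_of_ne hg hne))
  rw [RingHom.mem_ker] at hm hn
  have hfn : f n = 1 := by simpa [hm] using congrArg f hmn
  have hgm : g m = 1 := by simpa [hn] using congrArg g hmn
  refine ⟨f.eqLocus g, ?_, fun U hU => ?_⟩
  · intro h
    have : n ∈ f.eqLocus g := h ▸ trivial
    have : f n = g n := this
    simp [hfn, hn] at this
  · obtain ⟨r, hrU, hr'⟩ := SetLike.exists_of_lt hU
    have hr' : f r ≠ g r := hr'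
    refine eq_top_iff.2 fun t _ => ?_
    obtain ⟨r₁, hr₁⟩ : g r ∈ Set.range f := hr ▸ ⟨r, rfl⟩
    obtain ⟨t₁, ht₁⟩ : g t ∈ Set.range f := hr ▸ ⟨t, rfl⟩
    have hnot : r - r₁ ∉ RingHom.ker f := by
      rw [RingHom.mem_ker, map_sub, hr₁]; exact sub_ne_zero.2 hr'
    obtain ⟨y, i, hi, hyi⟩ := hf.exists_inv hnot
    rw [RingHom.mem_ker] at hi
    have hy : f y * (f r - g r) = 1 := by simpa [hi, hr₁] using congrArg f hyi
    obtain ⟨b, hb⟩ : f (y * (t - t₁)) ∈ Set.range g := hr ▸ ⟨_, rfl⟩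
    -- The element `s` takes the value `(f t - g t) / (f r - g r)` under both maps, so `t - s * r`
    -- is equalized.
    have hfs : f (n * (y * (t - t₁)) + m * b) = f (y * (t - t₁)) := by simp [hfn, hm]
    have hgs : g (n * (y * (t - t₁)) + m * b) = f (y * (t - t₁)) := by simp [hgm, hn, hb]
    set s := n * (y * (t - t₁)) + m * b
    have hs : s ∈ U := hU.le (hfs.trans hgs.symm)
    have hts : t - s * r ∈ U := by
      refine hU.le (show f _ = g _ from ?_)
      rw [map_sub, map_sub, map_mul, map_mul, hfs, hgs, map_mul, map_sub, ht₁]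
      linear_combination (-(f t - g t)) * hy
    simpa using add_mem hts (mul_mem hs hrU)

/-! ### Vanishing of the Jacobson radical. -/

open Polynomial in
-- Induction on the degree of a monic `p` with `x * p(x) = 0`. Once the constant term kills `x`, the
-- element `x * p.divX(x)` squares to zero and the degree drops. It does kill `x`: the annihilator
-- of `x` in `A` is radical, hence equal to its Jacobson radical.
theorem IsJacobsonRing.eq_zero_of_forall_exists_mul_one_add_eq_one {A T : Type*} [CommRing A]
    [IsJacobsonRing A] [Ring T] [IsReduced T] [Algebra A T] [Algebra.IsIntegral A T] {x : T}
    (hx : ∀ r, ∃ u, u * (1 + r * x) = 1) : x = 0 := by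
  have key : ∀ n : ℕ, ∀ p : A[X], p.Monic → p.natDegree = n → x * aeval x p = 0 → x = 0 := by
    intro n
    induction n with
    | zero =>
      intro p hp hn h
      rw [hp.natDegree_eq_zero.1 hn] at h
      simpa using h
    | succ n ih =>
      intro p hp hn h
      have hcomm : ∀ q : A[X], Commute x (aeval x q) := fun q => by
        simpa using (Commute.all X q).map (aeval (R := A) x)
      have hdecomp : aeval x p = aeval x p.divX * x + algebraMap A T (p.coeff 0) := by
        conv_lhs => rw [← divX_mul_X_add p]
        simp
      have hdiv : p.divX.Monic := by
        rw [Monic, leadingCoeff, natDegree_divX_eq_natDegree_tsub_one, coeff_divX, hn,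
          Nat.add_sub_cancel, ← hn]
        exact hp
      suffices hc : p.coeff 0 • x = 0 by
        refine ih p.divX hdiv (by rw [natDegree_divX_eq_natDegree_tsub_one, hn]; rfl) ?_
        rw [hdecomp, mul_add, ← Algebra.commutes, ← Algebra.smul_def, hc, add_zero] at h
        refine (pow_eq_zero_iff two_ne_zero).1 ?_
        rw [sq]
        calc x * aeval x p.divX * (x * aeval x p.divX)
            = x * (aeval x p.divX * x) * aeval x p.divX := by noncomm_ring
          _ = 0 := by rw [h, zero_mul]
      have hrad : (Ideal.torsionOf A T x).IsRadical := by
        rintro a ⟨k, hk⟩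
        rw [Ideal.mem_torsionOf_iff] at hk ⊢
        refine (pow_eq_zero_iff (Nat.succ_ne_zero k)).1 ?_
        rw [_root_.smul_pow, pow_succ', pow_succ, mul_smul, ← mul_smul_comm, hk, mul_zero, smul_zero]
      rw [← Ideal.mem_torsionOf_iff, ← IsJacobsonRing.out ‹_› hrad, Ideal.mem_jacobson_iff]
      intro b
      obtain ⟨u, hu⟩ := hx (-(b • aeval x p.divX))
      set s : A := 1 + b * p.coeff 0 with hs
      have hsx : s • (u * x) = x := by
        have h1 : p.coeff 0 • x = -(x * (aeval x p.divX * x)) := by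
          rw [hdecomp, mul_add, ← Algebra.commutes, ← Algebra.smul_def] at h
          exact eq_neg_of_add_eq_zero_right h
        have h2 : s • x = (1 + -(b • aeval x p.divX) * x) * x := by
          rw [hs, add_smul, one_smul, mul_smul, h1, ← mul_assoc, (hcomm p.divX).eq]
          simp [add_mul]
        rw [← mul_smul_comm, h2, ← mul_assoc, hu, one_mul]
      have hsk : ∀ k : ℕ, s ^ k • (u ^ k * x) = x := by
        intro k
        induction k with
        | zero => simp
        | succ k ihk =>
          calc s ^ (k + 1) • (u ^ (k + 1) * x) = s • (u * (s ^ k • (u ^ k * x))) := by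
                rw [mul_smul_comm, ← mul_smul, ← mul_assoc, pow_succ', pow_succ']
            _ = x := by rw [ihk, hsx]
      -- Scaling the monic equation of `u` by `s ^ P.natDegree` and using `hsk` puts `1` plus a
      -- multiple of `s` in the annihilator, so `s` is a unit modulo it.
      obtain ⟨P, hP, hPu⟩ := Algebra.IsIntegral.isIntegral (R := A) u
      rw [← aeval_def, aeval_eq_sum_range] at hPu
      have hsum : (∑ k ∈ Finset.range (P.natDegree + 1), P.coeff k * s ^ (P.natDegree - k)) • x
          = 0 := by
        calc _ = ∑ k ∈ Finset.range (P.natDegree + 1),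
              s ^ P.natDegree • ((P.coeff k • u ^ k) * x) := by
              rw [Finset.sum_smul]
              refine Finset.sum_congr rfl fun k hk => ?_
              have hk : k ≤ P.natDegree := Nat.lt_succ_iff.1 (Finset.mem_range.1 hk)
              conv_lhs => rw [← hsk k]
              rw [← mul_smul, smul_mul_assoc, ← mul_smul, mul_assoc, ← pow_add,
                Nat.sub_add_cancel hk, mul_comm]
          _ = 0 := by rw [← Finset.smul_sum, ← Finset.sum_mul, hPu, zero_mul, smul_zero]
      refine ⟨-∑ k ∈ Finset.range P.natDegree, P.coeff k * s ^ (P.natDegree - 1 - k), ?_⟩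
      rw [Ideal.mem_torsionOf_iff, ← neg_eq_zero, ← neg_smul, ← hsum]
      congr 1
      have hmul : ∑ k ∈ Finset.range P.natDegree, P.coeff k * s ^ (P.natDegree - k) =
          (∑ k ∈ Finset.range P.natDegree, P.coeff k * s ^ (P.natDegree - 1 - k)) * s := by
        rw [Finset.sum_mul]
        refine Finset.sum_congr rfl fun k hk => ?_
        have : P.natDegree - k = P.natDegree - 1 - k + 1 := by
          have := Finset.mem_range.1 hk; omega
        rw [this, pow_succ, mul_assoc]
      rw [Finset.sum_range_succ, hmul, Nat.sub_self, pow_zero, mul_one, hP.coeff_natDegree, hs]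
      ring
  obtain ⟨p, hp, h⟩ := Algebra.IsIntegral.isIntegral (R := A) x
  exact key _ p hp rfl (by rw [aeval_def, h, mul_zero])

/-! ### Division rings and commutativity. -/

theorem HasMaximalSubring.of_sup_closure_singleton_imp {T : Type*} [Ring T] {W : Subring T}
    (hW : W ≠ ⊤) (y : T) (h : W ⊔ Subring.closure {y} ≠ ⊤ → HasMaximalSubring T) :
    HasMaximalSubring T := by
  by_cases htop : W ⊔ Subring.closure {y} = ⊤
  · by_cases hyW : y ∈ W
    · rw [sup_eq_left.2 (by simpa [Subring.closure_le] using hyW)] at htop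
      exact absurd htop hW
    · exact .of_sup_closure_singleton hyW htop
  · exact h htop

/-- Artin-style shortening. After scaling to `e j = 1`, a commutator with some `y` not commuting
with an `e i` removes the `j` term, at the price of adjoining `y` to `W`. If all `e i` are central,
the sum is left multiplication by a nonzero element, which is onto and contradicts `W ≠ ⊤`. -/
theorem HasMaximalSubring.of_sum_mul_mul_mem {D ι : Type*} [DivisionRing D] (s : Finset ι)
    (c e : ι → D) (hc : LinearIndepOn (Subring.center D) c (s : Set ι)) (he : ∃ i ∈ s, e i ≠ 0)
    {W : Subring D} (hW : W ≠ ⊤) (h : ∀ d, ∑ i ∈ s, c i * d * e i ∈ W) :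
    HasMaximalSubring D := by
  classical
  induction s using Finset.induction_on generalizing e W with
  | empty => simp at he
  | insert j s hj ih =>
    have hcs : LinearIndepOn (Subring.center D) c (s : Set ι) := hc.mono (by simp)
    by_cases hej : e j = 0
    · refine ih e hcs ?_ hW fun d => by simpa [Finset.sum_insert hj, hej] using h d
      obtain ⟨i, hi, hi'⟩ := he
      rcases Finset.mem_insert.1 hi with rfl | hi
      · exact absurd hej hi'
      · exact ⟨i, hi, hi'⟩
    have main : ∀ W' : Subring D, W' ≠ ⊤ → ∀ e' : ι → D, e' j = 1 →
        (∀ d, ∑ i ∈ insert j s, c i * d * e' i ∈ W') → HasMaximalSubring D := by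
      intro W hW e he h
      by_cases hcen : ∀ i ∈ insert j s, e i ∈ Subring.center D
      · let g : ι → Subring.center D := fun i => if hi : e i ∈ Subring.center D then ⟨e i, hi⟩ else 0
        have hg : ∀ i ∈ insert j s, (g i : D) = e i := fun i hi => by simp [g, hcen i hi]
        have hne : ∑ i ∈ insert j s, g i • c i ≠ 0 := by
          intro h0
          have h1 := linearIndepOn_finset_iff.1 hc g h0 j (Finset.mem_insert_self _ _)
          have h2 := hg j (Finset.mem_insert_self _ _)
          rw [h1, he] at h2
          simp at h2
        have hsum : ∀ d, ∑ i ∈ insert j s, c i * d * e i = (∑ i ∈ insert j s, g i • c i) * d := by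
          intro d
          rw [Finset.sum_mul]
          refine Finset.sum_congr rfl fun i hi => ?_
          rw [Subring.smul_def, hg i hi, smul_eq_mul,
            (Subring.mem_center_iff.1 (hcen i hi) (c i * d)), mul_assoc]
        refine absurd (eq_top_iff.2 fun t _ => ?_) hW
        have := h ((∑ i ∈ insert j s, g i • c i)⁻¹ * t)
        rwa [hsum, mul_inv_cancel_left₀ hne] at this
      · push Not at hcen
        obtain ⟨i, hi, hie⟩ := hcen
        have his : i ∈ s := by
          refine (Finset.mem_insert.1 hi).resolve_left ?_
          rintro rfl
          exact hie (he ▸ one_mem _)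
        rw [Subring.mem_center_iff] at hie
        push Not at hie
        obtain ⟨y, hy⟩ := hie
        refine .of_sup_closure_singleton_imp hW y fun hy' =>
          ih (fun i => y * e i - e i * y) hcs ⟨i, his, sub_ne_zero.2 hy⟩ hy' fun d => ?_
        have h1 : ∑ i ∈ s, c i * d * (y * e i - e i * y) =
            ∑ i ∈ insert j s, c i * (d * y) * e i - (∑ i ∈ insert j s, c i * d * e i) * y := by
          rw [Finset.sum_insert hj, Finset.sum_insert hj, he, add_mul, Finset.sum_mul,
            mul_one, mul_one, mul_assoc (c j), add_sub_add_left_eq_sub, ← Finset.sum_sub_distrib]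
          exact Finset.sum_congr rfl fun i _ => by noncomm_ring
        rw [h1]
        exact sub_mem (le_sup_left (a := W) (h _)) (mul_mem (le_sup_left (a := W) (h _))
          (le_sup_right (a := W) (Subring.subset_closure (Set.mem_singleton _))))
    refine .of_sup_closure_singleton_imp hW (e j)⁻¹ fun hy => main _ hy (fun i => e i * (e j)⁻¹) (mul_inv_cancel₀ hej) ?_
    intro d
    simp_rw [← mul_assoc, ← Finset.sum_mul]
    exact mul_mem (le_sup_left (a := W) (h d))
      (le_sup_right (a := W) (Subring.subset_closure (Set.mem_singleton _)))

/-- Here `W` is the centralizer of `a`. Writing `(p(X) - p(Y)) / (X - Y) = ∑ X ^ i * e_i(Y)` for the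
minimal polynomial `p`, the sum `∑ a ^ i * d * e_i(a)` commutes with `a` because `p(a) = 0`. -/
theorem HasMaximalSubring.of_not_mem_center {D : Type*} [DivisionRing D] {a : D}
    (ha : IsIntegral (Subring.center D) a) (hac : a ∉ Subring.center D) :
    HasMaximalSubring D := by
  set p := minpoly (Subring.center D) a with hp
  set n := p.natDegree
  have hn : 0 < n := minpoly.natDegree_pos ha
  have hpa : ∑ j ∈ Finset.range (n + 1), p.coeff j • a ^ j = 0 := by
    rw [← Polynomial.aeval_eq_sum_range, hp, minpoly.aeval]
  let e : Fin n → D := fun i =>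
    ∑ j ∈ Finset.range (n + 1), if (i : ℕ) < j then p.coeff j • a ^ (j - 1 - i) else 0
  have hW : Subring.centralizer {a} ≠ ⊤ := by
    intro h
    refine hac (Subring.mem_center_iff.2 fun g => ?_)
    have : g ∈ Subring.centralizer {a} := h ▸ trivial
    exact (Subring.mem_centralizer_iff.1 this a rfl).symm
  have hlast : e ⟨n - 1, by omega⟩ = 1 := by
    have : ∀ j ∈ Finset.range n, (if n - 1 < j then p.coeff j • a ^ (j - 1 - (n - 1)) else 0)
        = (0 : D) := fun j hj => if_neg (by have := Finset.mem_range.1 hj; omega)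
    simp only [e]
    rw [Finset.sum_range_succ, Finset.sum_eq_zero this, if_pos (by omega), zero_add,
      Nat.sub_self, pow_zero, (minpoly.monic ha).coeff_natDegree, one_smul]
  refine .of_sum_mul_mul_mem Finset.univ (fun i : Fin n => a ^ (i : ℕ)) e ?_
    ⟨⟨n - 1, by omega⟩, Finset.mem_univ _, by rw [hlast]; exact one_ne_zero⟩ hW fun d => ?_
  · rw [Finset.coe_univ, linearIndepOn_univ_iff]
    exact linearIndependent_pow a
  have hsum : ∑ i : Fin n, a ^ (i : ℕ) * d * e i =
      ∑ j ∈ Finset.range (n + 1), p.coeff j • ∑ i ∈ Finset.range j,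
        a ^ i * d * a ^ (j - 1 - i) := by
    simp only [e, Finset.mul_sum]
    rw [Finset.sum_comm]
    refine Finset.sum_congr rfl fun j hj => ?_
    have hj : j ≤ n := Nat.lt_succ_iff.1 (Finset.mem_range.1 hj)
    rw [Fin.sum_univ_eq_sum_range
      (fun i => a ^ i * d * if i < j then p.coeff j • a ^ (j - 1 - i) else 0) n, Finset.smul_sum,
      ← Finset.sum_subset (Finset.range_mono hj)]
    · refine Finset.sum_congr rfl fun i hi => ?_
      rw [if_pos (Finset.mem_range.1 hi), mul_smul_comm]
    · intro i _ hi
      rw [if_neg (by simpa using hi), mul_zero]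
  have htel : ∀ j, a * (∑ i ∈ Finset.range j, a ^ i * d * a ^ (j - 1 - i)) -
      (∑ i ∈ Finset.range j, a ^ i * d * a ^ (j - 1 - i)) * a = a ^ j * d - d * a ^ j := by
    intro j
    have := Finset.sum_range_sub (fun i => a ^ i * d * a ^ (j - i)) j
    simp only [Nat.sub_self, pow_zero, mul_one, one_mul, Nat.sub_zero] at this
    rw [← this, Finset.mul_sum, Finset.sum_mul, ← Finset.sum_sub_distrib]
    refine Finset.sum_congr rfl fun i hi => ?_
    have hi := Finset.mem_range.1 hi
    have h1 : j - (i + 1) = j - 1 - i := by omega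
    have h2 : j - i = j - 1 - i + 1 := by omega
    rw [h1, h2, pow_succ a (j - 1 - i), pow_succ' a i]
    noncomm_ring
  rw [Subring.mem_centralizer_iff]
  intro b hb
  obtain rfl : a = b := Eq.symm hb
  rw [← sub_eq_zero, hsum, Finset.mul_sum, Finset.sum_mul, ← Finset.sum_sub_distrib]
  have hterm : ∀ j, a * p.coeff j • (∑ i ∈ Finset.range j, a ^ i * d * a ^ (j - 1 - i)) -
      p.coeff j • (∑ i ∈ Finset.range j, a ^ i * d * a ^ (j - 1 - i)) * a =
      (p.coeff j • a ^ j) * d - d * (p.coeff j • a ^ j) := by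
    intro j
    rw [mul_smul_comm, smul_mul_assoc, ← smul_sub, htel, smul_sub, smul_mul_assoc, mul_smul_comm]
  rw [Finset.sum_congr rfl fun j _ => hterm j, Finset.sum_sub_distrib, ← Finset.sum_mul,
    ← Finset.mul_sum, hpa, zero_mul, mul_zero, sub_zero]

theorem commute_of_not_hasMaximalSubring {A T : Type*} [CommRing A] [IsJacobsonRing A] [Ring T]
    [IsReduced T] [Algebra A T] [Algebra.IsIntegral A T] (h : ¬ HasMaximalSubring T) (x y : T) :
    x * y = y * x := by
  have hquot : ∀ L : Ideal T, L.IsMaximal → x * y - y * x ∈ L := by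
    intro L hL
    have := hL.isTwoSided_of_not_hasMaximalSubring h
    have hsurj := Ideal.Quotient.mk_surjective (I := L)
    have : Nontrivial (T ⧸ L) := Ideal.Quotient.nontrivial_iff.2 hL.ne_top
    have hinv : ∀ a : T ⧸ L, a ≠ 0 → ∃ b, b * a = 1 := by
      intro a ha
      obtain ⟨t, rfl⟩ := hsurj a
      obtain ⟨s, i, hi, hsi⟩ := hL.exists_inv (mt Ideal.Quotient.eq_zero_iff_mem.2 ha)
      refine ⟨Ideal.Quotient.mk L s, ?_⟩
      rw [← map_mul, ← map_one (Ideal.Quotient.mk L), ← hsi, map_add,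
        Ideal.Quotient.eq_zero_iff_mem.2 hi, add_zero]
    let _ : DivisionRing (T ⧸ L) := DivisionRing.ofIsUnitOrEqZero fun a => by
      by_cases ha : a = 0
      · exact .inr ha
      obtain ⟨b, hb⟩ := hinv a ha
      have hb0 : b ≠ 0 := by rintro rfl; simp at hb
      obtain ⟨c, hc⟩ := hinv b hb0
      have : c = a := by rw [← mul_one c, ← hb, ← mul_assoc, hc, one_mul]
      exact .inl ⟨⟨a, b, this ▸ hc, hb⟩, rfl⟩
    rw [← Ideal.Quotient.eq_zero_iff_mem, map_sub, map_mul, map_mul, sub_eq_zero]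
    by_contra hne
    let φ : A →+* Subring.center (T ⧸ L) :=
      ((Ideal.Quotient.mk L).comp (algebraMap A T)).codRestrict _ fun a => by
        rw [Subring.mem_center_iff]
        intro g
        obtain ⟨g, rfl⟩ := hsurj g
        simp only [RingHom.comp_apply]
        rw [← map_mul, ← map_mul, Algebra.commutes]
    refine h (.of_surjective _ hsurj (.of_not_mem_center (a := Ideal.Quotient.mk L x) ?_ ?_))
    · exact (Algebra.IsIntegral.isIntegral (R := A) x).map_of_comp_eq φ (Ideal.Quotient.mk L) rfl
    · intro hx
      exact hne ((Subring.mem_center_iff.1 hx _).symm)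
  rw [← sub_eq_zero]
  refine IsJacobsonRing.eq_zero_of_forall_exists_mul_one_add_eq_one (A := A) fun r => ?_
  by_contra! hr
  obtain ⟨L, hL, hle⟩ := Ideal.exists_le_maximal (Ideal.span {1 + r * (x * y - y * x)}) (by
    rw [Ne, Ideal.eq_top_iff_one, Ideal.mem_span_singleton']
    exact fun ⟨u, hu⟩ => hr u hu)
  refine hL.ne_top ((Ideal.eq_top_iff_one _).2 ?_)
  simpa using sub_mem (hle (Ideal.mem_span_singleton_self _)) (L.mul_mem_left r (hquot L hL))

/-! ### Fields without maximal subrings. -/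

open Polynomial in
-- `ϖ⁻¹` is not integral, as `V` is integrally closed, but adjoining it to the integral closure
-- gives `E`: up to units, every denominator is a power of `ϖ`.
theorem HasMaximalSubring.of_isDiscreteValuationRing (V E : Type*) [CommRing V] [IsDomain V]
    [IsDiscreteValuationRing V] [Field E] [Algebra V E] [FaithfulSMul V E]
    [Algebra.IsAlgebraic V E] : HasMaximalSubring E := by
  obtain ⟨ϖ, hϖ⟩ := IsDiscreteValuationRing.exists_irreducible V
  have hinj := FaithfulSMul.algebraMap_injective V E
  have hϖ0 : algebraMap V E ϖ ≠ 0 := (map_ne_zero_iff _ hinj).2 hϖ.ne_zero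
  refine .of_sup_closure_singleton (S := (integralClosure V E).toSubring)
    (x := (algebraMap V E ϖ)⁻¹) ?_ ?_
  · intro h
    have h : IsIntegral V (algebraMap V E ϖ)⁻¹ := h
    let K := FractionRing V
    let _ : Algebra K E := (IsFractionRing.lift hinj : K →+* E).toAlgebra
    have : IsScalarTower V K E := .of_algebraMap_eq fun v => (IsFractionRing.lift_algebraMap hinj v).symm
    have h2 : IsIntegral V (algebraMap V K ϖ)⁻¹ := by
      refine (isIntegral_algebraMap_iff (algebraMap K E).injective).1 ?_
      rwa [map_inv₀, ← IsScalarTower.algebraMap_apply]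
    obtain ⟨v, hv⟩ := IsIntegrallyClosed.isIntegral_iff.1 h2
    refine hϖ.not_isUnit (IsUnit.of_mul_eq_one v (IsFractionRing.injective V K ?_))
    rw [map_mul, hv, map_one, mul_inv_cancel₀]
    exact (map_ne_zero_iff _ (IsFractionRing.injective V K)).2 hϖ.ne_zero
  · refine eq_top_iff.2 fun e _ => ?_
    obtain ⟨y, hy, hye⟩ := (Algebra.IsAlgebraic.isAlgebraic (R := V) e).exists_integral_multiple
    obtain ⟨n, u, rfl⟩ := IsDiscreteValuationRing.eq_unit_mul_pow_irreducible hy hϖ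
    have h1 : (algebraMap V E ϖ ^ n * e) ∈ (integralClosure V E).toSubring := by
      have : IsIntegral V ((u⁻¹ : Vˣ) • ((u * ϖ ^ n : V) • e)) := by
        rw [Units.smul_def]
        exact hye.smul _
      rw [Units.smul_def, ← mul_smul, Units.inv_mul_cancel_left, Algebra.smul_def, map_pow] at this
      exact this
    have h2 : e = (algebraMap V E ϖ)⁻¹ ^ n * (algebraMap V E ϖ ^ n * e) := by
      rw [← mul_assoc, ← mul_pow, inv_mul_cancel₀ hϖ0, one_pow, one_mul]
    rw [h2]
    exact mul_mem (pow_mem (le_sup_right (a := (integralClosure V E).toSubring)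
      (Subring.subset_closure (Set.mem_singleton _))) _) (le_sup_left (a := (integralClosure V E).toSubring) h1)

theorem HasMaximalSubring.of_isDedekindDomain (A E : Type*) [CommRing A]
    [IsDedekindDomain A] [Field E] [Algebra A E] [FaithfulSMul A E]
    [Algebra.IsAlgebraic A E] (hA : ¬ IsField A) : HasMaximalSubring E := by
  obtain ⟨P, hP⟩ := Ideal.exists_maximal A
  have hP0 : P ≠ ⊥ := Ring.ne_bot_of_isMaximal_of_not_isField hP hA
  have hinj := FaithfulSMul.algebraMap_injective A E
  let V := Localization.AtPrime P
  have : IsDomain V := IsLocalization.isDomain_localization P.primeCompl_le_nonZeroDivisors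
  have : IsDiscreteValuationRing V :=
    IsLocalization.AtPrime.isDiscreteValuationRing_of_dedekind_domain A hP0 V
  have hunit : ∀ y : P.primeCompl, IsUnit (algebraMap A E y) := fun y => by
    rw [isUnit_iff_ne_zero, Ne, map_eq_zero_iff _ hinj]
    rintro h0
    exact y.2 (h0 ▸ P.zero_mem)
  let _ : Algebra V E := (IsLocalization.lift hunit : V →+* E).toAlgebra
  have : IsScalarTower A V E := .of_algebraMap_eq fun a => (IsLocalization.lift_eq hunit a).symm
  have : FaithfulSMul V E := (faithfulSMul_iff_algebraMap_injective V E).2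
    ((IsLocalization.lift_injective_iff hunit).2 fun x y => by
      rw [(IsLocalization.injective V P.primeCompl_le_nonZeroDivisors).eq_iff, hinj.eq_iff])
  have : Algebra.IsAlgebraic V E :=
    .extendScalars (R := A) (IsLocalization.injective V P.primeCompl_le_nonZeroDivisors)
  exact .of_isDiscreteValuationRing V E

open Polynomial in
-- Otherwise isolate one element `x i` of a transcendence basis and let `K` be generated by the
-- rest: `E` is algebraic over the Dedekind domain `K[x i]`.
theorem Algebra.IsAlgebraic.of_not_hasMaximalSubring (k E : Type*) [Field k] [Field E] [Algebra k E]
    (h : ¬ HasMaximalSubring E) : Algebra.IsAlgebraic k E := by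
  obtain ⟨ι, x, hx⟩ := exists_isTranscendenceBasis' k E
  rw [← hx.isEmpty_iff_isAlgebraic]
  by_contra hne
  obtain ⟨i⟩ := not_isEmpty_iff.1 hne
  let K := IntermediateField.adjoin k (x '' {i}ᶜ)
  have htr : Transcendental K (x i) := IntermediateField.transcendental_adjoin_iff.2
    (hx.1.transcendental_adjoin (by simp))
  let _ : Algebra K[X] E := (aeval (x i) : K[X] →ₐ[K] E).toRingHom.toAlgebra
  have hinj : Function.Injective (aeval (x i) : K[X] →ₐ[K] E) :=
    transcendental_iff_injective.1 htr
  have : FaithfulSMul K[X] E := (faithfulSMul_iff_algebraMap_injective _ _).2 hinj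
  have hle : Algebra.adjoin k (Set.range x) ≤
      (aeval (x i) : K[X] →ₐ[K] E).range.restrictScalars k := by
    refine Algebra.adjoin_le ?_
    rintro _ ⟨j, rfl⟩
    by_cases hj : j = i
    · exact ⟨X, by simp [hj]⟩
    · exact ⟨C ⟨x j, IntermediateField.subset_adjoin _ _ ⟨j, hj, rfl⟩⟩, by simp⟩
  let incl : Algebra.adjoin k (Set.range x) →+* (aeval (x i) : K[X] →ₐ[K] E).range :=
    (Subalgebra.inclusion hle).toRingHom
  let ψ : Algebra.adjoin k (Set.range x) →+* K[X] :=
    ((AlgEquiv.ofInjective _ hinj).symm.toAlgHom.toRingHom).comp incl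
  have hψ : ∀ a, aeval (x i) (ψ a) = (a : E) := fun a =>
    congrArg Subtype.val ((AlgEquiv.ofInjective _ hinj).apply_symm_apply (incl a))
  let _ : Algebra (Algebra.adjoin k (Set.range x)) K[X] := ψ.toAlgebra
  have : IsScalarTower (Algebra.adjoin k (Set.range x)) K[X] E :=
    .of_algebraMap_eq fun a => (hψ a).symm
  have := hx.isAlgebraic
  have : Algebra.IsAlgebraic K[X] E := .extendScalars (R := Algebra.adjoin k (Set.range x))
    (fun a b hab => Subtype.ext (by rw [← hψ, ← hψ]; exact congrArg _ hab))
  exact h (.of_isDedekindDomain K[X] E (Polynomial.not_isField K))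

theorem exists_charP_of_not_hasMaximalSubring (E : Type*) [Field E]
    (h : ¬ HasMaximalSubring E) : ∃ p : Nat.Primes, CharP E p := by
  obtain ⟨p, hp⟩ := CharP.exists E
  rcases CharP.char_is_prime_or_zero E p with hpr | rfl
  · exact ⟨⟨p, hpr⟩, hp⟩
  · have : CharZero E := CharP.charP_to_charZero E
    have : Algebra.IsAlgebraic ℚ E := .of_not_hasMaximalSubring ℚ E h
    have : Algebra.IsAlgebraic ℤ E := (IsFractionRing.comap_isAlgebraic_iff (K := ℚ)).2 this
    exact absurd (.of_isDedekindDomain ℤ E Int.not_isField) h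

theorem exists_ringHom_algebraicClosure_of_not_hasMaximalSubring (E : Type*) [Field E]
    (h : ¬ HasMaximalSubring E) :
    ∃ (p : ℕ) (_ : Fact p.Prime), Nonempty (E →+* AlgebraicClosure (ZMod p)) := by
  obtain ⟨p, hp⟩ := exists_charP_of_not_hasMaximalSubring E h
  have : Fact (p : ℕ).Prime := ⟨p.2⟩
  let _ := ZMod.algebra E p
  have : Algebra.IsAlgebraic (ZMod p) E := .of_not_hasMaximalSubring _ E h
  exact ⟨p, ‹_›, ⟨(IsAlgClosed.lift : E →ₐ[ZMod p] AlgebraicClosure (ZMod p)).toRingHom⟩⟩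

/-! ### The cardinality bound. -/

theorem exists_injective_algebraicClosure_zmod (p : ℕ) [Fact p.Prime] :
    ∃ e : AlgebraicClosure (ZMod p) → ℕ, Function.Injective e := by
  have h := Algebra.IsAlgebraic.cardinalMk_le_max (ZMod p) (AlgebraicClosure (ZMod p))
  have : #(ZMod p) ≤ ℵ₀ := Cardinal.mk_le_aleph0
  rw [max_eq_right this, Cardinal.mk_le_aleph0_iff] at h
  exact h.exists_injective_nat

theorem Cardinal.mk_le_two_power_two_power_of_not_hasMaximalSubring (T : Type*) [CommRing T]
    [IsReduced T] [IsJacobsonRing T] (h : ¬ HasMaximalSubring T) :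
    #T ≤ (2 : Cardinal) ^ ((2 : Cardinal) ^ ℵ₀) := by
  have hex : ∀ M : MaximalSpectrum T, ∃ (p : ℕ) (_ : Fact p.Prime)
      (f : T →+* AlgebraicClosure (ZMod p)), RingHom.ker f = M.asIdeal := by
    intro M
    have := M.isMaximal
    let _ := Ideal.Quotient.field M.asIdeal
    obtain ⟨p, hp, ⟨f⟩⟩ := exists_ringHom_algebraicClosure_of_not_hasMaximalSubring (T ⧸ M.asIdeal)
      (fun h' => h (.of_surjective _ Ideal.Quotient.mk_surjective h'))
    refine ⟨p, hp, f.comp (Ideal.Quotient.mk M.asIdeal), ?_⟩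
    rw [RingHom.ker_comp_of_injective _ f.injective, Ideal.mk_ker]
  choose p hp f hf using hex
  choose enc henc using exists_injective_algebraicClosure_zmod
  let g : MaximalSpectrum T → ℕ × Set ℕ := fun M => (p M, Set.range (enc (p M) ∘ f M))
  have hg : Function.Injective g := by
    have aux : ∀ (a b : ℕ) (_ : Fact a.Prime) (_ : Fact b.Prime)
        (u : T →+* AlgebraicClosure (ZMod a)) (v : T →+* AlgebraicClosure (ZMod b)),
        (RingHom.ker u).IsMaximal → (RingHom.ker v).IsMaximal → a = b →
        Set.range (enc a ∘ u) = Set.range (enc b ∘ v) → RingHom.ker u = RingHom.ker v := by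
      rintro a _ _ _ u v hu hv rfl huv
      by_contra hne
      rw [Set.range_comp, Set.range_comp, (henc a).image_injective.eq_iff] at huv
      exact h (.of_ringHom_pair u v hu hv hne huv)
    intro M N hMN
    have hMN := Prod.ext_iff.1 hMN
    ext1
    rw [← hf M, ← hf N]
    exact aux _ _ _ _ _ _ ((hf M).symm ▸ M.isMaximal) ((hf N).symm ▸ N.isMaximal) hMN.1 hMN.2
  -- Padding by `0` off the range of `g` indexes the residues of `t` by the fixed set `ℕ × Set ℕ`.
  have hinj : Function.Injective
      (fun (t : T) => Function.extend g (fun M => enc (p M) (f M t)) (fun _ => 0)) := by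
    intro s t hst
    have hst := Function.extend_injective hg _ hst
    have hJ : (⊥ : Ideal T).jacobson = ⊥ :=
      IsJacobsonRing.out ‹_› fun x ⟨n, hn⟩ => IsReduced.eq_zero x ⟨n, hn⟩
    rw [← sub_eq_zero, ← Ideal.mem_bot, ← hJ, Ideal.jacobson, Ideal.mem_sInf]
    rintro J ⟨-, hJ⟩
    change s - t ∈ (⟨J, hJ⟩ : MaximalSpectrum T).asIdeal
    rw [← hf ⟨J, hJ⟩, RingHom.mem_ker, map_sub, sub_eq_zero]
    exact henc _ (congrFun hst ⟨J, hJ⟩)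
  have hle := Cardinal.lift_mk_le_lift_mk_of_injective hinj
  have hcard : #(ℕ × Set ℕ → ℕ) = (2 : Cardinal) ^ ((2 : Cardinal) ^ ℵ₀) := by
    have h1 : ℵ₀ ≤ (2 : Cardinal) ^ ℵ₀ := (Cardinal.cantor ℵ₀).le
    rw [← Cardinal.power_def, Cardinal.mk_prod, Cardinal.mk_set, Cardinal.mk_nat,
      Cardinal.lift_id, Cardinal.lift_id, Cardinal.mul_eq_right h1 h1 Cardinal.aleph0_ne_zero,
      Cardinal.power_eq_two_power h1 (Cardinal.natCast_le_aleph0 (n := 2)) h1]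
  rw [hcard] at hle
  simpa using hle

/-! ### Von Neumann regularity and the conclusion. -/

theorem isVonNeumannRegularRing_of_krullDimLE_zero (R : Type*) [CommRing R] [IsReduced R]
    [Ring.KrullDimLE 0 R] : IsVonNeumannRegularRing R := by
  intro x
  let S : Submonoid R :=
    { carrier := {z | ∃ (n : ℕ) (y : R), z = x ^ n * (1 - x * y)}
      one_mem' := ⟨0, 0, by simp⟩
      mul_mem' := by
        rintro _ _ ⟨n, y, rfl⟩ ⟨m, z, rfl⟩
        exact ⟨n + m, y + z - x * y * z, by ring⟩ }
  -- A prime missing `S` would be maximal and omit `x`, hence contain some `1 - x * y`, which lies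
  -- in `S`.
  have h0 : (0 : R) ∈ S := by
    by_contra h0
    obtain ⟨P, hP, -, hdisj⟩ := Ideal.exists_le_prime_disjoint (⊥ : Ideal R) S (by
      rw [Set.disjoint_left]
      rintro z hz hzS
      rw [SetLike.mem_coe, Ideal.mem_bot] at hz
      exact h0 (hz ▸ hzS))
    have hmax : P.IsMaximal := hP.isMaximal'
    have hx : x ∉ P := fun hx => Set.disjoint_left.1 hdisj hx ⟨1, 0, by simp⟩
    obtain ⟨y, i, hi, hyi⟩ := hmax.exists_inv hx
    refine Set.disjoint_left.1 hdisj hi ⟨0, y, ?_⟩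
    rw [← hyi]; ring
  obtain ⟨n, y, hny⟩ := h0
  refine ⟨y, ?_⟩
  have : x * (1 - x * y) = 0 := by
    refine (pow_eq_zero_iff (Nat.succ_ne_zero n)).1 ?_
    rw [mul_pow, pow_succ, pow_succ]
    linear_combination (-(x * (1 - x * y) ^ n)) * hny
  linear_combination -this

theorem theorem4p13 {T : Type*} [Ring T] [Nontrivial T] [IsReduced T]
    [Algebra.IsIntegral (Subring.center T) T] :
    (IsJacobsonRing (Subring.center T) →
      HasMaximalSubring T ∨ (IsCommHilbertRing T ∧ #T ≤ (2 : Cardinal) ^ ((2 : Cardinal) ^ ℵ₀))) ∧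
    (ringKrullDim (Subring.center T) = 0 →
      HasMaximalSubring T ∨
        (IsCommHilbertRing T ∧ IsVonNeumannRegularRing T ∧ #T ≤ (2 : Cardinal) ^ ((2 : Cardinal) ^ ℵ₀))) := by
  have main : IsJacobsonRing (Subring.center T) → ¬ HasMaximalSubring T →
      Subring.center T = ⊤ ∧ IsCommHilbertRing T ∧
        #T ≤ (2 : Cardinal) ^ ((2 : Cardinal) ^ ℵ₀) := by
    intro hJ h
    have hcomm : ∀ x y : T, x * y = y * x :=
      commute_of_not_hasMaximalSubring (A := Subring.center T) h
    have htop : Subring.center T = ⊤ :=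
      eq_top_iff.2 fun x _ => Subring.mem_center_iff.2 fun y => hcomm y x
    let e : Subring.center T ≃+* T := (RingEquiv.subringCongr htop).trans Subring.topEquiv
    have hT : IsCommHilbertRing T := by
      refine ⟨hcomm, ?_⟩
      let _ : CommRing T := { ‹Ring T› with mul_comm := hcomm }
      exact (isJacobsonRing_iso e).1 hJ
    refine ⟨htop, hT, ?_⟩
    obtain ⟨_, hT⟩ := hT
    let _ : CommRing T := { ‹Ring T› with mul_comm := hcomm }
    exact Cardinal.mk_le_two_power_two_power_of_not_hasMaximalSubring T h
  refine ⟨fun hJ => or_iff_not_imp_left.2 fun h => (main hJ h).2, fun h0 =>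
    or_iff_not_imp_left.2 fun h => ?_⟩
  have : Ring.KrullDimLE 0 (Subring.center T) := Ring.krullDimLE_iff.2 h0.le
  obtain ⟨htop, hT, hcard⟩ := main inferInstance h
  refine ⟨hT, fun x => ?_, hcard⟩
  have : IsReduced (Subring.center T) :=
    isReduced_of_injective (Subring.center T).subtype Subtype.val_injective
  obtain ⟨y, hy⟩ := isVonNeumannRegularRing_of_krullDimLE_zero (Subring.center T)
    ⟨x, htop ▸ trivial⟩
  exact ⟨y, congrArg Subtype.val hy⟩
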